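/- Let $X$ be a separable real Banach space that contains a linear subspace isomorphic to $\ell_1$. Then there is an equivalent norm on $X$ such that, when the bidual $X^{**}$ carries the corresponding bidual norm, $B_{X^{**}}$ denotes its closed unit ball, and $b(X^{**})_1$ denotes the restriction to $B_{X^{**}}$ of the ball topology of $X^{**}$ (the coarsest topology on $X^{**}$ in which every norm-closed ball of $X^{**}$ is closed), the following holds: the topology $b(X^{**})_1$ is not Hausdorff and, moreover, every two nonempty $b(X^{**})_1$-open subsets of $B_{X^{**}}$ have nonempty intersection. -/

import Mathlib

open scoped Topology

noncomputable section

/-- An equivalent norm on the real normed space `X`: a seminorm `p` on `X` with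
`c ‖x‖ ≤ p x ≤ C ‖x‖` for some constants `c, C > 0` (so `p` is a norm). -/
structure EquivalentNorm (X : Type*) [NormedAddCommGroup X] [NormedSpace ℝ X]
    extends Seminorm ℝ X where
  exists_lower : ∃ c : ℝ, 0 < c ∧ ∀ x : X, c * ‖x‖ ≤ toSeminorm x
  exists_upper : ∃ C : ℝ, 0 < C ∧ ∀ x : X, toSeminorm x ≤ C * ‖x‖

/-- The vector space `X` equipped with the equivalent norm `p` instead of its original norm. -/
def Renormed {X : Type*} [NormedAddCommGroup X] [NormedSpace ℝ X]
    (_p : EquivalentNorm X) : Type _ := X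

namespace Renormed

variable {X : Type*} [NormedAddCommGroup X] [NormedSpace ℝ X] (p : EquivalentNorm X)

instance : AddCommGroup (Renormed p) := inferInstanceAs (AddCommGroup X)

instance : Module ℝ (Renormed p) := inferInstanceAs (Module ℝ X)

/-- The identity map, regarded as a linear isomorphism from `X` to the renormed space. -/
def equiv : X ≃ₗ[ℝ] Renormed p where
  toFun x := x
  invFun x := x
  map_add' _ _ := rfl
  map_smul' _ _ := rfl

/-- The new norm, bundled as a group norm. -/
def groupNorm : AddGroupNorm (Renormed p) where
  toFun x := p.toSeminorm ((equiv p).symm x)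
  map_zero' := by simp
  add_le' x y := by rw [map_add]; exact map_add_le_add p.toSeminorm _ _
  neg' x := by rw [map_neg]; exact map_neg_eq_map p.toSeminorm _
  eq_zero_of_map_eq_zero' := by
    intro x hx
    obtain ⟨c, hc, h⟩ := p.exists_lower
    have h1 : c * ‖(equiv p).symm x‖ ≤ 0 := (h _).trans_eq hx
    have h2 : ‖(equiv p).symm x‖ ≤ 0 := nonpos_of_mul_nonpos_right h1 hc
    exact (equiv p).symm.map_eq_zero_iff.1 (norm_le_zero_iff.1 h2)

instance : NormedAddCommGroup (Renormed p) :=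
  AddGroupNorm.toNormedAddCommGroup (groupNorm p)

/-- The norm of `Renormed p` is `p`. -/
theorem norm_equiv (x : X) : ‖equiv p x‖ = p.toSeminorm x := rfl

instance : NormedSpace ℝ (Renormed p) where
  norm_smul_le a x := (map_smul_eq_mul p.toSeminorm a ((equiv p).symm x)).le

end Renormed

/-- `X` contains a (linear) subspace isomorphic, as a topological vector space, to the real
space `ℓ₁` of absolutely summable sequences. -/
def ContainsEllOne (X : Type*) [NormedAddCommGroup X] [NormedSpace ℝ X] : Prop :=
  ∃ Y : Submodule ℝ X, Nonempty (Y ≃L[ℝ] lp (fun _ : ℕ => ℝ) 1)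

/-- The ball topology of `E`: the coarsest topology in which all norm closed balls are closed. -/
@[reducible]
def ballTopology (E : Type*) [NormedAddCommGroup E] : TopologicalSpace E :=
  TopologicalSpace.generateFrom {U : Set E | ∃ (x : E) (r : ℝ), U = (Metric.closedBall x r)ᶜ}

/-- The ball topology of `E` restricted to the closed unit ball of `E`. -/
@[reducible]
def unitBallTopology (E : Type*) [NormedAddCommGroup E] :
    TopologicalSpace (Metric.closedBall (0 : E) 1) :=
  TopologicalSpace.induced Subtype.val (ballTopology E)

/-- The bidual, with its bidual norm. -/
abbrev Bidual (X : Type*) [NormedAddCommGroup X] [NormedSpace ℝ X] : Type _ :=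
  StrongDual ℝ (StrongDual ℝ X)

end

/-!
If a sequence `u n` in the unit ball of the bidual satisfies `‖x - u n‖ → ‖x‖ + 1` for every `x`,
then it eventually leaves every closed ball that misses some point of the unit ball. So it
converges in the ball topology to all points of the unit ball at once, and no two nonempty open
sets can be disjoint.

Such a sequence is found in `X` itself. Let `e n` be the unit vector basis of a copy of `ℓ₁`.
Choices of signs extend to uniformly bounded functionals on `X`, and averaging them against Riesz
products gives, for coefficients `a n` in `[-1/2, 1/2]`, bounded functionals `H a` with
`H a (e n) = a n`. Orthogonality of the increments of a Riesz product yields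
`‖∑ σ k • (H (update a k (c k)) - H a)‖ ≤ K * √(∑ σ k ^ 2)`, uniformly in `a` and `c`. Hence
replacing the `k`-th coefficients in a whole family of functionals is a weakly null perturbation
as `k → ∞`.

Embed `X` into `ℓ_∞` by the functionals `d + H a`, with `d` small, that are at most `1/4` on every
`e n`, and give `X` the norm of its image. Changing the `k`-th coefficients sends `4 • e k` to any
prescribed point of the unit ball of `ℓ_∞` without increasing norms, and it moves the embedding
only by a weakly null amount. Consequently every norm-one functional `f` on `X` is a weak limit of
functionals `g k` in the dual unit ball with `g k (4 • e k)` close to `-1`, and evaluating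
`x - 4 • e k` at `g k` gives `‖x - 4 • e k‖ → ‖x‖ + 1` for all `x` in the bidual.
-/

noncomputable section

open Filter Function

section BallTopology

variable {E : Type*} [NormedAddCommGroup E]

/-- An L-orthogonal sequence: it lies in the unit ball and is asymptotically at the largest
possible distance from every point. -/
structure IsLOrthogonal (u : ℕ → E) : Prop where
  norm_le_one : ∀ n, ‖u n‖ ≤ 1
  tendsto_norm_sub : ∀ x, Tendsto (fun n => ‖x - u n‖) atTop (𝓝 (‖x‖ + 1))

namespace IsLOrthogonal

variable {u : ℕ → E}

theorem mem_unitBall (hu : IsLOrthogonal u) (n : ℕ) : u n ∈ Metric.closedBall (0 : E) 1 :=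
  mem_closedBall_zero_iff.2 (hu.norm_le_one n)

theorem tendsto_unitBallTopology (hu : IsLOrthogonal u) (z : Metric.closedBall (0 : E) 1) :
    Tendsto (fun n => (⟨u n, hu.mem_unitBall n⟩ : Metric.closedBall (0 : E) 1)) atTop
      (@nhds _ (unitBallTopology E) z) := by
  rw [@nhds_induced _ _ (ballTopology E)]
  refine tendsto_comap_iff.2 (TopologicalSpace.tendsto_nhds_generateFrom_iff.2 ?_)
  rintro _ ⟨c, r, rfl⟩ hz
  have hr : r < ‖c‖ + 1 := calc
    r < ‖(z : E) - c‖ := by simpa [dist_eq_norm] using hz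
    _ ≤ ‖(z : E)‖ + ‖c‖ := norm_sub_le _ _
    _ ≤ ‖c‖ + 1 := by linarith [mem_closedBall_zero_iff.1 z.2]
  filter_upwards [(hu.tendsto_norm_sub c).eventually_const_lt hr] with n hn
  simpa [dist_eq_norm, norm_sub_rev] using hn

theorem inter_nonempty_of_isOpen (hu : IsLOrthogonal u)
    {U V : Set (Metric.closedBall (0 : E) 1)} (hU : IsOpen[unitBallTopology E] U)
    (hV : IsOpen[unitBallTopology E] V) (hU₀ : U.Nonempty) (hV₀ : V.Nonempty) :
    (U ∩ V).Nonempty := by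
  obtain ⟨x, hx⟩ := hU₀
  obtain ⟨y, hy⟩ := hV₀
  have hxU := hu.tendsto_unitBallTopology x (@IsOpen.mem_nhds _ (unitBallTopology E) _ _ hU hx)
  have hyV := hu.tendsto_unitBallTopology y (@IsOpen.mem_nhds _ (unitBallTopology E) _ _ hV hy)
  obtain ⟨n, hn⟩ := (Eventually.and hxU hyV).exists
  exact ⟨_, hn⟩

theorem not_t2Space (hu : IsLOrthogonal u) :
    ¬ @T2Space (Metric.closedBall (0 : E) 1) (unitBallTopology E) := by
  intro hT2
  have hpos : 0 < ‖(0 : E)‖ + 1 := by positivity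
  obtain ⟨n, hn⟩ := ((hu.tendsto_norm_sub 0).eventually_const_lt hpos).exists
  have h : (⟨u n, hu.mem_unitBall n⟩ : Metric.closedBall (0 : E) 1) = ⟨0, by simp⟩ :=
    @tendsto_nhds_unique _ _ (unitBallTopology E) hT2 _ _ _ _ _
      (hu.tendsto_unitBallTopology _) (hu.tendsto_unitBallTopology _)
  have hun : u n = 0 := congrArg Subtype.val h
  simp [hun] at hn

end IsLOrthogonal

end BallTopology

section Bidual

variable {X E : Type*} [NormedAddCommGroup X] [NormedSpace ℝ X]
  [NormedAddCommGroup E] [NormedSpace ℝ E]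

theorem exists_norm_eq_one_lt_apply [Nontrivial X] (f : StrongDual ℝ X) {r : ℝ} (hr : r < ‖f‖) :
    ∃ x, ‖x‖ = 1 ∧ r < f x := by
  rw [← f.sSup_sphere_eq_norm] at hr
  obtain ⟨_, ⟨x, hx, rfl⟩, hrx⟩ :=
    exists_lt_of_lt_csSup ((NormedSpace.sphere_nonempty.2 zero_le_one).image _) hr
  rw [mem_sphere_zero_iff_norm] at hx
  rcases abs_cases (f x) with ⟨h, -⟩ | ⟨h, -⟩
  · exact ⟨x, hx, h ▸ hrx⟩
  · exact ⟨-x, by rwa [norm_neg], by rwa [map_neg, ← h]⟩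

theorem exists_comp_linearIsometry_eq (J : X →ₗᵢ[ℝ] E) (f : StrongDual ℝ X) :
    ∃ M : StrongDual ℝ E, ‖M‖ = ‖f‖ ∧ ∀ x, M (J x) = f x := by
  obtain ⟨M, hM, hnorm⟩ := exists_extension_norm_eq (LinearMap.range J.toLinearMap)
    (f.comp (J.equivRange.symm.toContinuousLinearEquiv : _ →L[ℝ] X))
  refine ⟨M, hnorm.trans ?_, fun x => ?_⟩
  · exact ContinuousLinearMap.opNorm_comp_linearIsometryEquiv f J.equivRange.symm
  · exact (hM (J.equivRange x)).trans (congrArg f (J.equivRange.symm_apply_apply x))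

/-- The operator `J` is the weak limit of operators dominated by `J` whose value at `v k` is
prescribed. -/
structure IsWeaklyAdjustable (J : X →L[ℝ] E) (v : ℕ → X) : Prop where
  norm_apply_le_one : ∀ n, ‖J (v n)‖ ≤ 1
  exists_tendsto : ∀ φ : E, ‖φ‖ ≤ 1 → ∃ T : ℕ → X →L[ℝ] E,
    (∀ k x, ‖T k x‖ ≤ ‖J x‖) ∧ (∀ k, T k (v k) = φ) ∧
      ∀ ψ : StrongDual ℝ (X →L[ℝ] E), Tendsto (fun k => ψ (T k)) atTop (𝓝 (ψ J))

theorem IsWeaklyAdjustable.eventually_lt_norm_sub [Nontrivial X] {J : X →ₗᵢ[ℝ] E} {v : ℕ → X}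
    (h : IsWeaklyAdjustable J.toContinuousLinearMap v) (x : Bidual X) {r : ℝ}
    (hr : r < ‖x‖ + 1) :
    ∀ᶠ k in atTop, r < ‖x - NormedSpace.inclusionInDoubleDual ℝ X (v k)‖ := by
  have : Nontrivial E := J.injective.nontrivial
  set ε := (‖x‖ + 1 - r) / 2 with hε
  have hε₀ : 0 < ε := by linarith
  obtain ⟨f, hf, hxf⟩ := exists_norm_eq_one_lt_apply x (r := ‖x‖ - ε) (by linarith)
  obtain ⟨M, hM, hMJ⟩ := exists_comp_linearIsometry_eq J f
  obtain ⟨φ, hφ, hMφ⟩ := exists_norm_eq_one_lt_apply (-M) (r := 1 - ε) (by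
    rw [norm_neg, hM, hf]; linarith)
  obtain ⟨T, hT, hTv, hlim⟩ := h.exists_tendsto φ hφ.le
  -- The functionals `M ∘ T k` tend weakly to `f`, yet their value at `v k` is `M φ ≈ -1`.
  have hlim' : Tendsto (fun k => x (M.comp (T k))) atTop (𝓝 (x f)) := by
    have hf_eq : f = M.comp J.toContinuousLinearMap := by ext z; exact (hMJ z).symm
    rw [hf_eq]
    exact hlim (x.comp (M.postcomp X))
  have hMT (k : ℕ) : ‖M.comp (T k)‖ ≤ 1 := by
    refine ContinuousLinearMap.opNorm_le_bound _ zero_le_one fun z => ?_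
    calc ‖M (T k z)‖ ≤ ‖M‖ * ‖T k z‖ := M.le_opNorm _
      _ ≤ 1 * ‖z‖ := by
        rw [hM, hf]
        gcongr
        exact (hT k z).trans_eq (J.norm_map z)
  filter_upwards [hlim'.eventually_const_lt hxf] with k hk
  calc r < x (M.comp (T k)) - M φ := by
        rw [neg_apply] at hMφ
        linarith
    _ = (x - NormedSpace.inclusionInDoubleDual ℝ X (v k)) (M.comp (T k)) := by
        simp [hTv]
    _ ≤ ‖x - NormedSpace.inclusionInDoubleDual ℝ X (v k)‖ :=
        (le_abs_self _).trans (ContinuousLinearMap.unit_le_opNorm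
          (x - NormedSpace.inclusionInDoubleDual ℝ X (v k)) (M.comp (T k)) (hMT k))

theorem IsWeaklyAdjustable.isLOrthogonal_inclusionInDoubleDual [Nontrivial X] {J : X →ₗᵢ[ℝ] E}
    {v : ℕ → X} (h : IsWeaklyAdjustable J.toContinuousLinearMap v) :
    IsLOrthogonal fun n => NormedSpace.inclusionInDoubleDual ℝ X (v n) := by
  have hv (n : ℕ) : ‖NormedSpace.inclusionInDoubleDual ℝ X (v n)‖ ≤ 1 :=
    (NormedSpace.double_dual_bound ℝ X (v n)).trans
      ((J.norm_map (v n)).symm.trans_le (h.norm_apply_le_one n))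
  refine ⟨hv, fun x => tendsto_order.2 ⟨fun r hr => h.eventually_lt_norm_sub x hr,
    fun r hr => .of_forall fun n => lt_of_le_of_lt ?_ hr⟩⟩
  calc ‖x - NormedSpace.inclusionInDoubleDual ℝ X (v n)‖
    _ ≤ ‖x‖ + ‖NormedSpace.inclusionInDoubleDual ℝ X (v n)‖ :=
        norm_sub_le x (NormedSpace.inclusionInDoubleDual ℝ X (v n))
    _ ≤ ‖x‖ + 1 := by grw [hv n]

end Bidual

section Renorming

variable {X Y E : Type*} [NormedAddCommGroup X] [NormedSpace ℝ X]
  [NormedAddCommGroup Y] [NormedSpace ℝ Y] [NormedAddCommGroup E] [NormedSpace ℝ E]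

theorem IsWeaklyAdjustable.comp {J : X →L[ℝ] E} {v : ℕ → X} (h : IsWeaklyAdjustable J v)
    (S : Y →L[ℝ] X) {w : ℕ → Y} (hw : ∀ n, S (w n) = v n) :
    IsWeaklyAdjustable (J.comp S) w where
  norm_apply_le_one n := by simpa [hw] using h.norm_apply_le_one n
  exists_tendsto φ hφ := by
    obtain ⟨T, hT, hTv, hlim⟩ := h.exists_tendsto φ hφ
    exact ⟨fun k => (T k).comp S, fun k y => hT k (S y), fun k => by simp [hw, hTv],
      fun ψ => hlim (ψ.comp (S.precomp E))⟩

/-- The norm `x ↦ ‖J x‖` on `X`, for an operator `J` that is bounded below. -/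
def pullbackNorm (J : X →L[ℝ] E) (hJ : ∃ c > 0, ∀ x, c * ‖x‖ ≤ ‖J x‖) : EquivalentNorm X where
  toSeminorm := (normSeminorm ℝ E).comp J.toLinearMap
  exists_lower := hJ
  exists_upper := J.bound

namespace pullbackNorm

variable (J : X →L[ℝ] E) (hJ : ∃ c > 0, ∀ x, c * ‖x‖ ≤ ‖J x‖)

/-- The identity map, as a bounded operator from the renormed space back to `X`. -/
def toOriginal : Renormed (pullbackNorm J hJ) →L[ℝ] X :=
  LinearMap.mkContinuousOfExistsBound (Renormed.equiv (pullbackNorm J hJ)).symm.toLinearMap <| by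
    obtain ⟨c, hc, h⟩ := hJ
    exact ⟨c⁻¹, fun x => (le_inv_mul_iff₀ hc).2 (h _)⟩

/-- The operator `J`, which is an isometry for the norm pulled back along it. -/
def isometry : Renormed (pullbackNorm J hJ) →ₗᵢ[ℝ] E where
  toLinearMap := (J.comp (toOriginal J hJ)).toLinearMap
  norm_map' _ := rfl

end pullbackNorm

theorem IsWeaklyAdjustable.exists_isLOrthogonal [Nontrivial X] {J : X →L[ℝ] E} {v : ℕ → X}
    (h : IsWeaklyAdjustable J v) (hJ : ∃ c > 0, ∀ x, c * ‖x‖ ≤ ‖J x‖) :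
    ∃ u : ℕ → Bidual (Renormed (pullbackNorm J hJ)), IsLOrthogonal u := by
  have : Nontrivial (Renormed (pullbackNorm J hJ)) :=
    (Renormed.equiv (pullbackNorm J hJ)).injective.nontrivial
  have hadj : IsWeaklyAdjustable (pullbackNorm.isometry J hJ).toContinuousLinearMap
      fun n => Renormed.equiv (pullbackNorm J hJ) (v n) :=
    h.comp (pullbackNorm.toOriginal J hJ) fun _ => rfl
  exact ⟨_, hadj.isLOrthogonal_inclusionInDoubleDual⟩

end Renorming

section UpperEllTwo

variable {ι E : Type*} [NormedAddCommGroup E] [NormedSpace ℝ E]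

/-- The family `u` satisfies an upper `ℓ₂`-estimate with constant `K`. -/
def HasUpperEllTwoEstimate (u : ι → E) (K : ℝ) : Prop :=
  ∀ (s : Finset ι) (σ : ι → ℝ), ‖∑ k ∈ s, σ k • u k‖ ≤ K * √(∑ k ∈ s, σ k ^ 2)

theorem HasUpperEllTwoEstimate.summable_sq_apply {u : ι → E} {K : ℝ}
    (hu : HasUpperEllTwoEstimate u K) (ψ : StrongDual ℝ E) : Summable fun k => ψ (u k) ^ 2 := by
  refine summable_of_sum_le (fun k => sq_nonneg _) (c := (‖ψ‖ * K) ^ 2) fun s => ?_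
  set S := ∑ k ∈ s, ψ (u k) ^ 2 with hS
  have hS₀ : 0 ≤ S := Finset.sum_nonneg fun k _ => sq_nonneg _
  have hle : √S * √S ≤ ‖ψ‖ * K * √S := calc
    √S * √S = ψ (∑ k ∈ s, ψ (u k) • u k) := by
      rw [Real.mul_self_sqrt hS₀]
      simp only [hS, map_sum, map_smul, smul_eq_mul, sq]
    _ ≤ ‖ψ‖ * ‖∑ k ∈ s, ψ (u k) • u k‖ := (le_abs_self _).trans (ψ.le_opNorm _)
    _ ≤ ‖ψ‖ * (K * √S) := by gcongr; exact hu s _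
    _ = ‖ψ‖ * K * √S := by ring
  rcases hS₀.eq_or_lt with h₀ | hpos
  · exact h₀ ▸ sq_nonneg _
  · rw [← Real.sq_sqrt hS₀]
    gcongr
    exact le_of_mul_le_mul_right hle (Real.sqrt_pos.2 hpos)

theorem HasUpperEllTwoEstimate.tendsto_apply {u : ι → E} {K : ℝ}
    (hu : HasUpperEllTwoEstimate u K) (ψ : StrongDual ℝ E) :
    Tendsto (fun k => ψ (u k)) cofinite (𝓝 0) := by
  have hsq := (hu.summable_sq_apply ψ).tendsto_cofinite_zero.sqrt
  simp only [Real.sqrt_sq_eq_abs, Real.sqrt_zero] at hsq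
  exact (tendsto_zero_iff_abs_tendsto_zero _).2 hsq

end UpperEllTwo

section RieszProducts

variable {ι : Type*} [DecidableEq ι]

/-- The `i`-th Rademacher function on the cube of finite subsets of `ι`. -/
def finsetSign (A : Finset ι) (i : ι) : ℝ := if i ∈ A then 1 else -1

theorem abs_finsetSign (A : Finset ι) (i : ι) : |finsetSign A i| = 1 := by
  unfold finsetSign
  split_ifs <;> simp

theorem finsetSign_sq (A : Finset ι) (i : ι) : finsetSign A i ^ 2 = 1 := by
  rw [← sq_abs, abs_finsetSign, one_pow]

theorem half_le_one_add_mul_finsetSign {x : ℝ} (hx : |x| ≤ 1 / 2) (A : Finset ι) (i : ι) :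
    1 / 2 ≤ 1 + x * finsetSign A i := by
  have h : |x * finsetSign A i| ≤ 1 / 2 := by rwa [abs_mul, abs_finsetSign, mul_one]
  linarith [(abs_le.1 h).1]

/-- The Riesz product `∏ i ∈ s, (1 + a i * εᵢ)`, as a density on the cube of subsets of `s`
normalized to have total mass one: the coordinates are independent signs with means `a i`. -/
def rieszWeight (s : Finset ι) (a : ι → ℝ) (A : Finset ι) : ℝ :=
  ∏ i ∈ s, (1 + a i * finsetSign A i) / 2

theorem sum_rieszWeight (s : Finset ι) (a : ι → ℝ) :
    ∑ A ∈ s.powerset, rieszWeight s a A = 1 := by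
  have hsplit : ∀ A ∈ s.powerset, rieszWeight s a A =
      (∏ i ∈ A, (1 + a i) / 2) * ∏ i ∈ s \ A, (1 - a i) / 2 := by
    intro A hA
    rw [rieszWeight, ← Finset.prod_sdiff (Finset.mem_powerset.1 hA), mul_comm]
    congr 1 <;> refine Finset.prod_congr rfl fun i hi => ?_
    · simp [finsetSign, hi]
    · simp [finsetSign, (Finset.mem_sdiff.1 hi).2, sub_eq_add_neg]
  rw [Finset.sum_congr rfl hsplit, ← Finset.prod_add]
  exact Finset.prod_eq_one fun i _ => by ring

theorem rieszWeight_nonneg (s : Finset ι) {a : ι → ℝ} (ha : ∀ i, |a i| ≤ 1 / 2) (A : Finset ι) :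
    0 ≤ rieszWeight s a A :=
  Finset.prod_nonneg fun i _ => by linarith [half_le_one_add_mul_finsetSign (ha i) A i]

theorem rieszWeight_update {s : Finset ι} {k : ι} (hk : k ∈ s) (a : ι → ℝ) (c : ℝ)
    (A : Finset ι) :
    rieszWeight s (update a k c) A =
      (1 + c * finsetSign A k) / 2 * rieszWeight (s.erase k) a A := by
  rw [rieszWeight, ← Finset.mul_prod_erase s _ hk, update_self]
  congr 1
  refine Finset.prod_congr rfl fun i hi => ?_
  rw [update_of_ne (Finset.ne_of_mem_erase hi)]

theorem rieszWeight_eq_mul_erase {s : Finset ι} {k : ι} (hk : k ∈ s) (a : ι → ℝ)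
    (A : Finset ι) :
    rieszWeight s a A = (1 + a k * finsetSign A k) / 2 * rieszWeight (s.erase k) a A := by
  rw [← rieszWeight_update hk, update_eq_self]

theorem sum_rieszWeight_mul_finsetSign {s : Finset ι} {k : ι} (hk : k ∈ s) (a : ι → ℝ) :
    ∑ A ∈ s.powerset, rieszWeight s a A * finsetSign A k = a k := by
  have hcomb (A : Finset ι) : rieszWeight s a A * finsetSign A k =
      rieszWeight s (update a k 1) A - (1 - a k) * rieszWeight s (update a k 0) A := by
    rw [rieszWeight_update hk, rieszWeight_update hk, rieszWeight_eq_mul_erase hk]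
    linear_combination a k / 2 * rieszWeight (s.erase k) a A * finsetSign_sq A k
  simp only [hcomb, Finset.sum_sub_distrib, ← Finset.mul_sum, sum_rieszWeight]
  ring

/-- The relative change of a Riesz product when its `k`-th coefficient is changed to `c`. -/
def rieszIncrement (a : ι → ℝ) (k : ι) (c : ℝ) (A : Finset ι) : ℝ :=
  (c - a k) * finsetSign A k / (1 + a k * finsetSign A k)

theorem rieszWeight_mul_one_add_rieszIncrement {s : Finset ι} {k : ι} (hk : k ∈ s) {a : ι → ℝ}
    (hak : |a k| ≤ 1 / 2) (c : ℝ) (A : Finset ι) :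
    rieszWeight s a A * (1 + rieszIncrement a k c A) = rieszWeight s (update a k c) A := by
  have hpos : 1 + a k * finsetSign A k ≠ 0 := by
    linarith [half_le_one_add_mul_finsetSign hak A k]
  rw [rieszWeight_update hk, rieszWeight_eq_mul_erase hk, rieszIncrement]
  field_simp
  ring

theorem abs_rieszIncrement_le {a : ι → ℝ} {k : ι} (hak : |a k| ≤ 1 / 2) {c : ℝ}
    (hc : |c| ≤ 1 / 2) (A : Finset ι) : |rieszIncrement a k c A| ≤ 2 := by
  have hden := half_le_one_add_mul_finsetSign hak A k
  have hpos : 0 < 1 + a k * finsetSign A k := by linarith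
  rw [rieszIncrement, abs_div, abs_mul, abs_finsetSign, abs_of_pos hpos, div_le_iff₀ hpos]
  linarith [abs_sub c (a k)]

theorem sum_rieszWeight_mul_rieszIncrement_mul {s : Finset ι} {j k : ι} (hj : j ∈ s) (hk : k ∈ s)
    (hjk : j ≠ k) {a : ι → ℝ} (haj : |a j| ≤ 1 / 2) (hak : |a k| ≤ 1 / 2) (c d : ℝ) :
    ∑ A ∈ s.powerset, rieszWeight s a A * (rieszIncrement a j c A * rieszIncrement a k d A) =
      0 := by
  -- Each summand is a mixed second difference of Riesz products, all of total mass one.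
  have hsplit (A : Finset ι) :
      rieszWeight s a A * (rieszIncrement a j c A * rieszIncrement a k d A) =
        rieszWeight s (update (update a j c) k d) A - rieszWeight s (update a j c) A
          - rieszWeight s (update a k d) A + rieszWeight s a A := by
    have hak' : update a j c k = a k := update_of_ne hjk.symm c a
    rw [← rieszWeight_mul_one_add_rieszIncrement hk (hak'.symm ▸ hak),
      ← rieszWeight_mul_one_add_rieszIncrement hj haj,
      ← rieszWeight_mul_one_add_rieszIncrement hk hak]
    simp only [rieszIncrement, hak']
    ring
  simp only [hsplit, Finset.sum_sub_distrib, Finset.sum_add_distrib, sum_rieszWeight]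
  ring

theorem sum_mul_sq_sum_of_orthogonal {α κ : Type*} (S : Finset α) (t : Finset κ) (w : α → ℝ)
    {ρ : κ → α → ℝ} (hρ : ∀ j ∈ t, ∀ k ∈ t, j ≠ k → ∑ A ∈ S, w A * (ρ j A * ρ k A) = 0)
    (σ : κ → ℝ) :
    ∑ A ∈ S, w A * (∑ k ∈ t, σ k * ρ k A) ^ 2 =
      ∑ k ∈ t, σ k ^ 2 * ∑ A ∈ S, w A * ρ k A ^ 2 := by
  calc ∑ A ∈ S, w A * (∑ k ∈ t, σ k * ρ k A) ^ 2
    _ = ∑ j ∈ t, ∑ k ∈ t, σ j * σ k * ∑ A ∈ S, w A * (ρ j A * ρ k A) := by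
      simp_rw [sq, Finset.sum_mul_sum, Finset.mul_sum]
      rw [Finset.sum_comm]
      refine Finset.sum_congr rfl fun j _ => Finset.sum_comm.trans ?_
      exact Finset.sum_congr rfl fun k _ => Finset.sum_congr rfl fun A _ => by ring
    _ = ∑ k ∈ t, σ k ^ 2 * ∑ A ∈ S, w A * ρ k A ^ 2 := by
      refine Finset.sum_congr rfl fun j hj => ?_
      rw [Finset.sum_eq_single_of_mem j hj fun k hk hkj => by rw [hρ j hj k hk hkj.symm, mul_zero]]
      simp only [sq]

theorem sum_rieszWeight_mul_abs_sum_rieszIncrement_le {s t : Finset ι} (hts : t ⊆ s)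
    {a c : ι → ℝ} (ha : ∀ i, |a i| ≤ 1 / 2) (hc : ∀ i, |c i| ≤ 1 / 2) (σ : ι → ℝ) :
    ∑ A ∈ s.powerset, rieszWeight s a A * |∑ k ∈ t, σ k * rieszIncrement a k (c k) A| ≤
      2 * √(∑ k ∈ t, σ k ^ 2) := by
  have hw : ∀ A ∈ s.powerset, 0 ≤ rieszWeight s a A := fun A _ => rieszWeight_nonneg s ha A
  have hsq_le (k : ι) : ∑ A ∈ s.powerset, rieszWeight s a A * rieszIncrement a k (c k) A ^ 2 ≤ 4 :=
    calc
      _ ≤ ∑ A ∈ s.powerset, rieszWeight s a A * 2 ^ 2 := by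
        refine Finset.sum_le_sum fun A hA => mul_le_mul_of_nonneg_left ?_ (hw A hA)
        exact sq_le_sq' (abs_le.1 (abs_rieszIncrement_le (ha k) (hc k) A)).1
          (abs_le.1 (abs_rieszIncrement_le (ha k) (hc k) A)).2
      _ = 4 := by rw [← Finset.sum_mul, sum_rieszWeight]; norm_num
  refine abs_le_of_sq_le_sq' ?_ (by positivity) |>.2
  calc (∑ A ∈ s.powerset, rieszWeight s a A * |∑ k ∈ t, σ k * rieszIncrement a k (c k) A|) ^ 2
    _ ≤ ∑ A ∈ s.powerset, rieszWeight s a A * |∑ k ∈ t, σ k * rieszIncrement a k (c k) A| ^ 2 :=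
      Real.pow_arith_mean_le_arith_mean_pow_of_even _ _ _ hw (sum_rieszWeight s a) even_two
    _ = ∑ k ∈ t, σ k ^ 2 *
        ∑ A ∈ s.powerset, rieszWeight s a A * rieszIncrement a k (c k) A ^ 2 := by
      simp only [sq_abs]
      exact sum_mul_sq_sum_of_orthogonal _ _ _ (fun j hj k hk hjk =>
        sum_rieszWeight_mul_rieszIncrement_mul (hts hj) (hts hk) hjk (ha j) (ha k) _ _) σ
    _ ≤ ∑ k ∈ t, σ k ^ 2 * 4 := by gcongr with k; exact hsq_le k
    _ = (2 * √(∑ k ∈ t, σ k ^ 2)) ^ 2 := by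
      rw [mul_pow, Real.sq_sqrt (Finset.sum_nonneg fun k _ => sq_nonneg _), ← Finset.sum_mul]
      ring

variable {E : Type*} [NormedAddCommGroup E] [NormedSpace ℝ E]

/-- The mean of `f` over the cube of subsets of `s` with respect to a Riesz product. -/
def rieszMean (s : Finset ι) (f : Finset ι → E) (a : ι → ℝ) : E :=
  ∑ A ∈ s.powerset, rieszWeight s a A • f A

theorem norm_rieszMean_le (s : Finset ι) {f : Finset ι → E} {C : ℝ} (hf : ∀ A, ‖f A‖ ≤ C)
    {a : ι → ℝ} (ha : ∀ i, |a i| ≤ 1 / 2) : ‖rieszMean s f a‖ ≤ C := by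
  calc ‖rieszMean s f a‖
    _ ≤ ∑ A ∈ s.powerset, rieszWeight s a A * C := by
      refine norm_sum_le_of_le _ fun A _ => ?_
      rw [norm_smul, Real.norm_of_nonneg (rieszWeight_nonneg s ha A)]
      exact mul_le_mul_of_nonneg_left (hf A) (rieszWeight_nonneg s ha A)
    _ = C := by rw [← Finset.sum_mul, sum_rieszWeight, one_mul]

theorem norm_sum_rieszMean_update_sub_le {s t : Finset ι} (hts : t ⊆ s) {f : Finset ι → E} {C : ℝ}
    (hf : ∀ A, ‖f A‖ ≤ C) {a c : ι → ℝ} (ha : ∀ i, |a i| ≤ 1 / 2) (hc : ∀ i, |c i| ≤ 1 / 2)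
    (σ : ι → ℝ) :
    ‖∑ k ∈ t, σ k • (rieszMean s f (update a k (c k)) - rieszMean s f a)‖ ≤
      2 * C * √(∑ k ∈ t, σ k ^ 2) := by
  have hC : 0 ≤ C := (norm_nonneg _).trans (hf ∅)
  have hdiff : ∀ k ∈ t, rieszMean s f (update a k (c k)) - rieszMean s f a =
      ∑ A ∈ s.powerset, (rieszWeight s a A * rieszIncrement a k (c k) A) • f A := by
    intro k hk
    rw [rieszMean, rieszMean, ← Finset.sum_sub_distrib]
    refine Finset.sum_congr rfl fun A _ => ?_
    rw [← sub_smul, ← rieszWeight_mul_one_add_rieszIncrement (hts hk) (ha k)]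
    ring_nf
  have hsum : ∑ k ∈ t, σ k • (rieszMean s f (update a k (c k)) - rieszMean s f a) =
      ∑ A ∈ s.powerset,
        (rieszWeight s a A * ∑ k ∈ t, σ k * rieszIncrement a k (c k) A) • f A := by
    rw [Finset.sum_congr rfl fun k hk => by rw [hdiff k hk, Finset.smul_sum], Finset.sum_comm]
    refine Finset.sum_congr rfl fun A _ => ?_
    simp only [smul_smul, ← Finset.sum_smul, Finset.mul_sum]
    congr 1
    exact Finset.sum_congr rfl fun k _ => by ring
  rw [hsum]
  calc ‖∑ A ∈ s.powerset, (rieszWeight s a A * ∑ k ∈ t, σ k * rieszIncrement a k (c k) A) • f A‖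
    _ ≤ ∑ A ∈ s.powerset,
        rieszWeight s a A * |∑ k ∈ t, σ k * rieszIncrement a k (c k) A| * C := by
      refine norm_sum_le_of_le _ fun A _ => ?_
      rw [norm_smul, norm_mul, Real.norm_of_nonneg (rieszWeight_nonneg s ha A), Real.norm_eq_abs]
      exact mul_le_mul_of_nonneg_left (hf A)
        (mul_nonneg (rieszWeight_nonneg s ha A) (abs_nonneg _))
    _ ≤ 2 * √(∑ k ∈ t, σ k ^ 2) * C := by
      rw [← Finset.sum_mul]
      gcongr
      exact sum_rieszWeight_mul_abs_sum_rieszIncrement_le hts ha hc σ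
    _ = 2 * C * √(∑ k ∈ t, σ k ^ 2) := by ring

end RieszProducts

section StableInterpolation

variable {ι X : Type*} [NormedAddCommGroup X] [NormedSpace ℝ X]

theorem exists_strongDual_lp_one_apply_single [DecidableEq ι] (s : ι → ℝ) (hs : ∀ i, |s i| ≤ 1) :
    ∃ φ : StrongDual ℝ (lp (fun _ : ι => ℝ) 1), ‖φ‖ ≤ 1 ∧ ∀ i, φ (lp.single 1 i 1) = s i := by
  let b : lp (fun _ : ι => ℝ) ⊤ := ⟨s, memℓp_infty ⟨1, Set.forall_mem_range.2 hs⟩⟩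
  have hb : ‖b‖ ≤ 1 := lp.norm_le_of_forall_le zero_le_one hs
  have hmul : ∀ _ : ι, ‖ContinuousLinearMap.mul ℝ ℝ‖ ≤ (1 : NNReal) := fun _ =>
    ContinuousLinearMap.opNorm_mul_le ℝ ℝ
  refine ⟨lp.dualPairing ⊤ 1 (fun _ => ContinuousLinearMap.mul ℝ ℝ) hmul b, ?_, fun i => ?_⟩
  · refine (ContinuousLinearMap.le_opNorm _ b).trans ?_
    exact mul_le_one₀ (lp.norm_dualPairing _ hmul) (norm_nonneg b) hb
  · rw [lp.dualPairing_apply, tsum_eq_single i fun j hj => by simp [hj]]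
    simp [b]

theorem ContainsEllOne.exists_interpolating (hX : ContainsEllOne X) :
    ∃ (e : ℕ → X) (C : ℝ), (∀ n, ‖e n‖ ≤ C) ∧ ∀ s : ℕ → ℝ, (∀ n, |s n| ≤ 1) →
      ∃ f : StrongDual ℝ X, ‖f‖ ≤ C ∧ ∀ n, f (e n) = s n := by
  obtain ⟨Y, ⟨Φ⟩⟩ := hX
  let Φ₁ : Y →L[ℝ] lp (fun _ : ℕ => ℝ) 1 := Φ
  let Φ₂ : lp (fun _ : ℕ => ℝ) 1 →L[ℝ] Y := Φ.symm
  refine ⟨fun n => Φ₂ (lp.single 1 n 1), max ‖Φ₁‖ ‖Φ₂‖, fun n => ?_, fun s hs => ?_⟩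
  · refine le_max_of_le_right (Φ₂.unit_le_opNorm _ ?_)
    rw [lp.norm_single zero_lt_one, norm_one]
  · obtain ⟨φ, hφ, hφs⟩ := exists_strongDual_lp_one_apply_single s hs
    obtain ⟨f, hf, hfnorm⟩ := exists_extension_norm_eq Y (φ.comp Φ₁)
    refine ⟨f, le_max_of_le_left ?_, fun n => ?_⟩
    · calc ‖f‖ = ‖φ.comp Φ₁‖ := hfnorm
        _ ≤ ‖φ‖ * ‖Φ₁‖ := φ.opNorm_comp_le Φ₁
        _ ≤ ‖Φ₁‖ := mul_le_of_le_one_left Φ₁.opNorm_nonneg hφ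
    · rw [hf, ← hφs]
      exact congrArg φ (Φ.apply_symm_apply _)

theorem exists_tendsto_apply_of_norm_le {α : Type*} (U : Ultrafilter α) {C : ℝ}
    {g : α → StrongDual ℝ X} (hg : ∀ s, ‖g s‖ ≤ C) :
    ∃ f : StrongDual ℝ X, ‖f‖ ≤ C ∧ ∀ x, Tendsto (fun s => g s x) U (𝓝 (f x)) := by
  have hK := WeakDual.isCompact_closedBall (𝕜 := ℝ) (0 : StrongDual ℝ X) C
  obtain ⟨f, hf, hle⟩ := hK.ultrafilter_le_nhds (U.map fun s => StrongDual.toWeakDual (g s)) (by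
    rw [le_principal_iff, Ultrafilter.mem_coe, Ultrafilter.mem_map]
    exact univ_mem' fun s => mem_closedBall_zero_iff.2 (hg s))
  exact ⟨WeakDual.toStrongDual f, mem_closedBall_zero_iff.1 hf, fun x =>
    (WeakDual.eval_continuous x).continuousAt.tendsto.comp hle⟩

/-- The functionals `H a`, for `a : ι → [-1/2, 1/2]`, are bounded by `C` and interpolate `a` on the
vectors `e i`, and independent changes of single coordinates of `a` move them in almost orthogonal
directions. -/
structure IsStableInterpolation [DecidableEq ι] (e : ι → X) (H : (ι → ℝ) → StrongDual ℝ X)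
    (C : ℝ) : Prop where
  norm_le : ∀ a : ι → ℝ, (∀ i, |a i| ≤ 1 / 2) → ‖H a‖ ≤ C
  apply_eq : ∀ a : ι → ℝ, (∀ i, |a i| ≤ 1 / 2) → ∀ i, H a (e i) = a i
  upperEllTwo : ∀ a c : ι → ℝ, (∀ i, |a i| ≤ 1 / 2) → (∀ i, |c i| ≤ 1 / 2) →
    HasUpperEllTwoEstimate (fun k => H (update a k (c k)) - H a) (2 * C)

theorem IsStableInterpolation.ne_zero [DecidableEq ι] {e : ι → X}
    {H : (ι → ℝ) → StrongDual ℝ X} {C : ℝ} (hH : IsStableInterpolation e H C) (i : ι) :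
    e i ≠ 0 := by
  intro hi
  have h := hH.apply_eq (fun _ => 1 / 2) (fun _ => (abs_of_pos one_half_pos).le) i
  norm_num [hi] at h

theorem rieszMean_apply_of_mem [DecidableEq ι] {e : ι → X} {f : Finset ι → StrongDual ℝ X}
    (hf : ∀ A i, f A (e i) = finsetSign A i) {s : Finset ι} {i : ι} (hi : i ∈ s) (a : ι → ℝ) :
    rieszMean s f a (e i) = a i := by
  simp only [rieszMean, sum_apply, smul_apply, hf,
    smul_eq_mul, sum_rieszWeight_mul_finsetSign hi]

theorem exists_isStableInterpolation [DecidableEq ι] {e : ι → X} {C : ℝ}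
    (he : ∀ s : ι → ℝ, (∀ i, |s i| ≤ 1) → ∃ f : StrongDual ℝ X, ‖f‖ ≤ C ∧ ∀ i, f (e i) = s i) :
    ∃ H : (ι → ℝ) → StrongDual ℝ X, IsStableInterpolation e H C := by
  choose f hf hfe using fun A : Finset ι => he (finsetSign A) fun i => (abs_finsetSign A i).le
  let U : Ultrafilter (Finset ι) := .of atTop
  have hU : (U : Filter (Finset ι)) ≤ atTop := Ultrafilter.of_le _
  have hlim (a : ι → ℝ) (ha : ∀ i, |a i| ≤ 1 / 2) := exists_tendsto_apply_of_norm_le U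
    fun s => norm_rieszMean_le s hf ha
  choose! H hHC hH using hlim
  refine ⟨H, hHC, fun a ha i => ?_, fun a c ha hc t σ => ?_⟩
  · refine tendsto_nhds_unique (hH a ha (e i)) (tendsto_const_nhds.congr' ?_)
    filter_upwards [hU (eventually_ge_atTop {i})] with s hs
    exact (rieszMean_apply_of_mem hfe (Finset.singleton_subset_iff.1 hs) a).symm
  · have hC : 0 ≤ C := (norm_nonneg _).trans (hf ∅)
    have hupd (k : ι) : ∀ i, |update a k (c k) i| ≤ 1 / 2 :=
      (forall_update_iff a fun _ y => |y| ≤ 1 / 2).2 ⟨hc k, fun i _ => ha i⟩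
    refine ContinuousLinearMap.opNorm_le_bound _ (by positivity) fun x => ?_
    have hx : Tendsto (fun s => ‖(∑ k ∈ t, σ k •
        (rieszMean s f (update a k (c k)) - rieszMean s f a)) x‖) U
        (𝓝 ‖(∑ k ∈ t, σ k • (H (update a k (c k)) - H a)) x‖) := by
      simp only [sum_apply, smul_apply, sub_apply]
      exact (tendsto_finsetSum t fun k _ =>
        ((hH _ (hupd k) x).sub (hH a ha x)).const_smul (σ k)).norm
    refine le_of_tendsto hx ?_
    filter_upwards [hU (eventually_ge_atTop t)] with s hs
    exact ContinuousLinearMap.le_of_opNorm_le _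
      (norm_sum_rieszMean_update_sub_le hs hf ha hc σ) x

end StableInterpolation

section StableFamily

variable {X : Type*} [NormedAddCommGroup X] [NormedSpace ℝ X]

/-- The evaluation operator `x ↦ (h i x)ᵢ` into `ℓ_∞` given by a bounded family of functionals. -/
def evalFamily {I : Type*} (h : I → StrongDual ℝ X) (hh : ∃ C, ∀ i, ‖h i‖ ≤ C) :
    X →L[ℝ] lp (fun _ : I => ℝ) ⊤ :=
  LinearMap.mkContinuousOfExistsBound
    { toFun x := ⟨fun i => h i x, memℓp_infty <| by
        obtain ⟨C, hC⟩ := hh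
        exact ⟨C * ‖x‖, Set.forall_mem_range.2 fun i => (h i).le_of_opNorm_le (hC i) x⟩⟩
      map_add' x y := by ext i; exact map_add (h i) x y
      map_smul' c x := by ext i; exact map_smul (h i) c x } <| by
    obtain ⟨C, hC⟩ := hh
    exact ⟨max C 0, fun x => lp.norm_le_of_forall_le (by positivity) fun i =>
      (h i).le_of_opNorm_le ((hC i).trans (le_max_left C 0)) x⟩

/-- The indices of the norming family of functionals `d + H a`: a small functional `d`, which makes
the family separate points, and coefficients `a` for which `d + H a` is at most `1/4` on each
`e n`. -/
structure RieszIndex (e : ℕ → X) (η : ℝ) where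
  shift : StrongDual ℝ X
  coeff : ℕ → ℝ
  norm_shift_le : ‖shift‖ ≤ η
  abs_coeff_le : ∀ n, |coeff n| ≤ 1 / 2
  abs_apply_add_le : ∀ n, |shift (e n) + coeff n| ≤ 1 / 4

namespace RieszIndex

variable {e : ℕ → X} {η : ℝ}

theorem abs_apply_le_quarter (he : ∀ n, η * ‖e n‖ ≤ 1 / 4) {d : StrongDual ℝ X} (hd : ‖d‖ ≤ η)
    (n : ℕ) : |d (e n)| ≤ 1 / 4 :=
  (d.le_of_opNorm_le hd (e n)).trans (he n)

/-- The index with functional `d` and zero coefficients. -/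
def ofShift (he : ∀ n, η * ‖e n‖ ≤ 1 / 4) (d : StrongDual ℝ X) (hd : ‖d‖ ≤ η) :
    RieszIndex e η where
  shift := d
  coeff := 0
  norm_shift_le := hd
  abs_coeff_le _ := by norm_num
  abs_apply_add_le n := by simpa using abs_apply_le_quarter he hd n

/-- The coefficient at `n` that makes `shift + H coeff` take the value `y` at `e n`. -/
def coeffFor (i : RieszIndex e η) (y : ℝ) (n : ℕ) : ℝ := y - i.shift (e n)

theorem abs_coeffFor_le (he : ∀ n, η * ‖e n‖ ≤ 1 / 4) (i : RieszIndex e η) {y : ℝ}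
    (hy : |y| ≤ 1 / 4) (n : ℕ) : |i.coeffFor y n| ≤ 1 / 2 := by
  have hd := abs_apply_le_quarter he i.norm_shift_le n
  unfold coeffFor
  linarith [abs_sub y (i.shift (e n))]

/-- The index `i` with its `k`-th coefficient changed so that `shift + H coeff` takes the value `y`
at `e k`. -/
def adjust (he : ∀ n, η * ‖e n‖ ≤ 1 / 4) (i : RieszIndex e η) (k : ℕ) (y : ℝ)
    (hy : |y| ≤ 1 / 4) : RieszIndex e η where
  shift := i.shift
  coeff := update i.coeff k (i.coeffFor y k)
  norm_shift_le := i.norm_shift_le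
  abs_coeff_le := (forall_update_iff i.coeff fun _ a => |a| ≤ 1 / 2).2
    ⟨i.abs_coeffFor_le he hy k, fun n _ => i.abs_coeff_le n⟩
  abs_apply_add_le := (forall_update_iff i.coeff fun n a => |i.shift (e n) + a| ≤ 1 / 4).2
    ⟨by simpa [coeffFor] using hy, fun n _ => i.abs_apply_add_le n⟩

theorem shift_add_coeff_adjust (he : ∀ n, η * ‖e n‖ ≤ 1 / 4) (i : RieszIndex e η) (k : ℕ) {y : ℝ}
    (hy : |y| ≤ 1 / 4) : (i.adjust he k y hy).shift (e k) + (i.adjust he k y hy).coeff k = y := by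
  simp [adjust, coeffFor]

end RieszIndex

namespace IsStableInterpolation

variable {e : ℕ → X} {η C : ℝ} {H : (ℕ → ℝ) → StrongDual ℝ X}

theorem norm_shift_add_le (hH : IsStableInterpolation e H C) (i : RieszIndex e η) :
    ‖i.shift + H i.coeff‖ ≤ η + C :=
  norm_add_le_of_le i.norm_shift_le (hH.norm_le _ i.abs_coeff_le)

/-- The embedding of `X` into `ℓ_∞` by the functionals `d + H a`. -/
def embedding (hH : IsStableInterpolation e H C) (η : ℝ) :
    X →L[ℝ] lp (fun _ : RieszIndex e η => ℝ) ⊤ :=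
  evalFamily (fun i => i.shift + H i.coeff) ⟨η + C, hH.norm_shift_add_le⟩

theorem embedding_apply (hH : IsStableInterpolation e H C) (x : X) (i : RieszIndex e η) :
    hH.embedding η x i = i.shift x + H i.coeff x := rfl

theorem abs_shift_add_le_norm_embedding (hH : IsStableInterpolation e H C) (x : X)
    (i : RieszIndex e η) : |i.shift x + H i.coeff x| ≤ ‖hH.embedding η x‖ :=
  lp.norm_apply_le_norm ENNReal.top_ne_zero (hH.embedding η x) i

theorem embedding_four_smul_apply (hH : IsStableInterpolation e H C) (n : ℕ)
    (i : RieszIndex e η) :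
    hH.embedding η ((4 : ℝ) • e n) i = 4 * (i.shift (e n) + i.coeff n) := by
  rw [embedding_apply, map_smul, map_smul, hH.apply_eq _ i.abs_coeff_le, smul_eq_mul, smul_eq_mul,
    mul_add]

theorem exists_lower_bound_embedding (hH : IsStableInterpolation e H C) (hη : 0 < η)
    (he : ∀ n, η * ‖e n‖ ≤ 1 / 4) : ∃ c > 0, ∀ x, c * ‖x‖ ≤ ‖hH.embedding η x‖ := by
  refine ⟨η, hη, fun x => ?_⟩
  obtain ⟨g, hg, hgx⟩ := exists_dual_vector'' ℝ x
  have hd : ‖η • g‖ ≤ η := by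
    rw [norm_smul, Real.norm_of_nonneg hη.le]
    exact mul_le_of_le_one_right hη.le hg
  have hplus : |η * ‖x‖ + H 0 x| ≤ ‖hH.embedding η x‖ := by
    simpa [RieszIndex.ofShift, hgx] using
      hH.abs_shift_add_le_norm_embedding x (.ofShift he (η • g) hd)
  have hminus : |-(η * ‖x‖) + H 0 x| ≤ ‖hH.embedding η x‖ := by
    simpa [RieszIndex.ofShift, hgx] using
      hH.abs_shift_add_le_norm_embedding x (.ofShift he (-(η • g)) ((norm_neg _).trans_le hd))
  linarith [(abs_le.1 hplus).2, (abs_le.1 hminus).1]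

/-- The embedding with every index `i` adjusted so that `e k` is sent to `φ / 4`. -/
def adjustedEmbedding (hH : IsStableInterpolation e H C) (he : ∀ n, η * ‖e n‖ ≤ 1 / 4)
    (φ : RieszIndex e η → ℝ) (hφ : ∀ i, |φ i / 4| ≤ 1 / 4) (k : ℕ) :
    X →L[ℝ] lp (fun _ : RieszIndex e η => ℝ) ⊤ :=
  evalFamily (fun i => (i.adjust he k (φ i / 4) (hφ i)).shift +
    H (i.adjust he k (φ i / 4) (hφ i)).coeff) ⟨η + C, fun _ => hH.norm_shift_add_le _⟩

theorem adjustedEmbedding_apply (hH : IsStableInterpolation e H C) (he : ∀ n, η * ‖e n‖ ≤ 1 / 4)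
    (φ : RieszIndex e η → ℝ) (hφ : ∀ i, |φ i / 4| ≤ 1 / 4) (k : ℕ) (x : X) (i : RieszIndex e η) :
    hH.adjustedEmbedding he φ hφ k x i = hH.embedding η x (i.adjust he k (φ i / 4) (hφ i)) := rfl

theorem adjustedEmbedding_sub_apply (hH : IsStableInterpolation e H C)
    (he : ∀ n, η * ‖e n‖ ≤ 1 / 4) (φ : RieszIndex e η → ℝ) (hφ : ∀ i, |φ i / 4| ≤ 1 / 4) (k : ℕ)
    (x : X) (i : RieszIndex e η) :
    (hH.adjustedEmbedding he φ hφ k - hH.embedding η) x i =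
      (H (update i.coeff k (i.coeffFor (φ i / 4) k)) - H i.coeff) x :=
  add_sub_add_left_eq_sub _ _ _

theorem hasUpperEllTwoEstimate_adjustedEmbedding_sub (hH : IsStableInterpolation e H C)
    (he : ∀ n, η * ‖e n‖ ≤ 1 / 4) (φ : RieszIndex e η → ℝ) (hφ : ∀ i, |φ i / 4| ≤ 1 / 4) :
    HasUpperEllTwoEstimate (fun k => hH.adjustedEmbedding he φ hφ k - hH.embedding η)
      (2 * C) := by
  intro t σ
  have hC : 0 ≤ C := (norm_nonneg _).trans (hH.norm_le 0 fun _ => by norm_num)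
  refine ContinuousLinearMap.opNorm_le_bound _ (by positivity) fun x =>
    lp.norm_le_of_forall_le (by positivity) fun i => ?_
  have hcoord : (∑ k ∈ t, σ k • (hH.adjustedEmbedding he φ hφ k - hH.embedding η)) x i =
      (∑ k ∈ t, σ k • (H (update i.coeff k (i.coeffFor (φ i / 4) k)) - H i.coeff)) x := by
    simp only [sum_apply, smul_apply, lp.coeFn_sum, Finset.sum_apply, lp.coeFn_smul, Pi.smul_apply,
      adjustedEmbedding_sub_apply]
  rw [hcoord]
  exact ContinuousLinearMap.le_of_opNorm_le _
    (hH.upperEllTwo _ (i.coeffFor (φ i / 4)) i.abs_coeff_le (i.abs_coeffFor_le he (hφ i)) t σ) x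

theorem isWeaklyAdjustable_embedding (hH : IsStableInterpolation e H C)
    (he : ∀ n, η * ‖e n‖ ≤ 1 / 4) :
    IsWeaklyAdjustable (hH.embedding η) fun n => (4 : ℝ) • e n where
  norm_apply_le_one n := by
    refine lp.norm_le_of_forall_le zero_le_one fun i => ?_
    rw [hH.embedding_four_smul_apply, norm_mul, Real.norm_eq_abs, Real.norm_eq_abs,
      abs_of_pos four_pos]
    linarith [i.abs_apply_add_le n]
  exists_tendsto φ hφ := by
    have hφ₄ (i : RieszIndex e η) : |φ i / 4| ≤ 1 / 4 := by
      have hφi : |φ i| ≤ 1 := (lp.norm_apply_le_norm ENNReal.top_ne_zero φ i).trans hφ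
      rw [abs_div, abs_of_pos (four_pos (α := ℝ))]
      gcongr
    refine ⟨hH.adjustedEmbedding he φ hφ₄, fun k x => ?_, fun k => ?_, fun ψ => ?_⟩
    · exact lp.norm_le_of_forall_le (norm_nonneg _) fun i =>
        lp.norm_apply_le_norm ENNReal.top_ne_zero (hH.embedding η x)
          (i.adjust he k (φ i / 4) (hφ₄ i))
    · ext i
      rw [hH.adjustedEmbedding_apply, hH.embedding_four_smul_apply, i.shift_add_coeff_adjust,
        mul_div_cancel₀ _ four_ne_zero]
    · have hsub := (hH.hasUpperEllTwoEstimate_adjustedEmbedding_sub he φ hφ₄).tendsto_apply ψ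
      rw [Nat.cofinite_eq_atTop] at hsub
      simpa using hsub.add_const (ψ (hH.embedding η))

end IsStableInterpolation

end StableFamily

theorem corollary4p6_general {X : Type*} [NormedAddCommGroup X] [NormedSpace ℝ X]
    (hX : ContainsEllOne X) :
    ∃ p : EquivalentNorm X,
      (¬ @T2Space (Metric.closedBall (0 : Bidual (Renormed p)) 1)
          (unitBallTopology (Bidual (Renormed p)))) ∧
      ∀ U V : Set (Metric.closedBall (0 : Bidual (Renormed p)) 1),
        IsOpen[unitBallTopology (Bidual (Renormed p))] U →
        IsOpen[unitBallTopology (Bidual (Renormed p))] V →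
        U.Nonempty → V.Nonempty → (U ∩ V).Nonempty := by
  obtain ⟨e, C, he, hinterp⟩ := hX.exists_interpolating
  obtain ⟨H, hH⟩ := exists_isStableInterpolation hinterp
  have : Nontrivial X := nontrivial_of_ne _ _ (hH.ne_zero 0)
  obtain ⟨η, hη, hηe⟩ : ∃ η > 0, ∀ n, η * ‖e n‖ ≤ 1 / 4 := by
    refine ⟨1 / (4 * (max C 1)), by positivity, fun n => ?_⟩
    rw [div_mul_eq_mul_div, div_le_div_iff₀ (by positivity) (by positivity)]
    linarith [he n, le_max_left C 1]
  have hlower := hH.exists_lower_bound_embedding hη hηe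
  obtain ⟨u, hu⟩ := (hH.isWeaklyAdjustable_embedding hηe).exists_isLOrthogonal hlower
  exact ⟨pullbackNorm (hH.embedding η) hlower, hu.not_t2Space,
    fun _ _ => hu.inter_nonempty_of_isOpen⟩

end

theorem corollary4p6 {X : Type*} [NormedAddCommGroup X] [NormedSpace ℝ X] [CompleteSpace X]
    [TopologicalSpace.SeparableSpace X] (hX : ContainsEllOne X) :
    ∃ p : EquivalentNorm X,
      (¬ @T2Space (Metric.closedBall (0 : Bidual (Renormed p)) 1)
          (unitBallTopology (Bidual (Renormed p)))) ∧
      ∀ U V : Set (Metric.closedBall (0 : Bidual (Renormed p)) 1),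
        IsOpen[unitBallTopology (Bidual (Renormed p))] U →
        IsOpen[unitBallTopology (Bidual (Renormed p))] V →
        U.Nonempty → V.Nonempty → (U ∩ V).Nonempty :=
  corollary4p6_general hX
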